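/- For $n\ge 1$ let $\mathcal P_n\subset\mathbb R^n$ be the polytope of all $(x_1,\dots,x_n)$ with $0\le x_i\le 1$ for $1\le i\le n$ and $x_i+x_{i+1}\le 1$ for $1\le i\le n-1$ (for $n\ge 2$ the bounds $x_i\le 1$ are redundant; $\mathcal P_1=[0,1]$). The chain polytope of a finite poset $P$ is the set of all $x\in\mathbb R^P$ with $x_a\ge 0$ for every $a\in P$ and $x_{p_1}+\cdots+x_{p_k}\le 1$ for every chain $p_1\prec\cdots\prec p_k$ of $P$. The zig-zag poset $\mathbf Z_n=\{a_1,\dots,a_n\}$ is the poset whose order is generated by $a_1\prec a_2\succ a_3\prec\cdots$. The Ehrhart $\delta$-polynomial of a lattice polytope $\mathcal P\subset\mathbb R^m$ is the unique polynomial $\delta(\mathcal P;t)$, of degree at most $\dim\mathcal P$, with $$\sum_{k\ge 0}|k\mathcal P\cap\mathbb Z^m|\,t^k=\frac{\delta(\mathcal P;t)}{(1-t)^{\dim\mathcal P+1}}.$$ A polynomial $a_0+a_1t+\cdots+a_dt^d$ of degree $d$ is unimodal if $a_0\le\cdots\le a_i\ge a_{i+1}\ge\cdots\ge a_d$ for some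 $0\le i\le d$. **Theorem (Kirillov's conjecture).** For every $n\ge 1$, $\mathcal P_n$ is the chain polytope of the zig-zag poset $\mathbf Z_n$ (with $x_i$ the coordinate at $a_i$), its Ehrhart $\delta$-polynomial $\delta(\mathcal P_n;t)$ exists and has integer coefficients, and $\delta(\mathcal P_n;t)$ is unimodal. -/

import Mathlib

open scoped Pointwise Polynomial

/-- The number of integer points in the `k`-th dilate of a set `P ⊆ ℝ^ι`, i.e. `|kP ∩ ℤ^ι|`. -/
noncomputable def latticePointCount {ι : Type*} (P : Set (ι → ℝ)) (k : ℕ) : ℕ :=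
  Set.ncard {z : ι → ℤ | (fun i => (z i : ℝ)) ∈ (k : ℝ) • P}

/-- The dimension of `P`: the dimension of its affine hull. -/
noncomputable def affineDim {ι : Type*} (P : Set (ι → ℝ)) : ℕ :=
  Module.finrank ℝ (vectorSpan ℝ P)

/-- The Ehrhart series `∑_{k ≥ 0} |kP ∩ ℤ^ι| t^k`, as a formal power series. -/
noncomputable def ehrhartSeries {ι : Type*} (P : Set (ι → ℝ)) : PowerSeries ℤ :=
  PowerSeries.mk fun k => (latticePointCount P k : ℤ)

/-- `δ` is the Ehrhart `δ`-polynomial of `P`: all dilates of `P` have finitely many lattice points,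
`deg δ ≤ dim P`, and the Ehrhart series of `P` equals `δ(t) / (1 - t) ^ (dim P + 1)`. -/
structure IsEhrhartDelta {ι : Type*} (P : Set (ι → ℝ)) (δ : ℤ[X]) : Prop where
  finite : ∀ k : ℕ, {z : ι → ℤ | (fun i => (z i : ℝ)) ∈ (k : ℝ) • P}.Finite
  natDegree_le : δ.natDegree ≤ affineDim P
  series_eq : ehrhartSeries P * (1 - PowerSeries.X) ^ (affineDim P + 1) = (δ : PowerSeries ℤ)

/-- A set has at most one Ehrhart `δ`-polynomial. -/
theorem IsEhrhartDelta.unique {ι : Type*} {P : Set (ι → ℝ)} {δ ε : ℤ[X]}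
    (hδ : IsEhrhartDelta P δ) (hε : IsEhrhartDelta P ε) : δ = ε :=
  Polynomial.coe_injective ℤ (hδ.series_eq.symm.trans hε.series_eq)

/-- A polynomial `a₀ + a₁ x + ⋯ + a_d x^d` of degree `d` is unimodal if
`a₀ ≤ ⋯ ≤ a_i ≥ a_{i+1} ≥ ⋯ ≥ a_d` for some `0 ≤ i ≤ d`. -/
def IsUnimodal (f : ℤ[X]) : Prop :=
  ∃ i ≤ f.natDegree,
    (∀ j, j < i → f.coeff j ≤ f.coeff (j + 1)) ∧
    (∀ j, i ≤ j → j < f.natDegree → f.coeff (j + 1) ≤ f.coeff j)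

/-- The chain polytope of a finite poset. -/
def chainPolytope (α : Type*) [PartialOrder α] : Set (α → ℝ) :=
  {x | (∀ a, 0 ≤ x a) ∧ ∀ s : Finset α, IsChain (· ≤ ·) (s : Set α) → ∑ a ∈ s, x a ≤ 1}

/-- The underlying set of the zig-zag poset of order `n`; the element `i : Fin n` plays the role
of `a_{i+1}`. -/
def ZigZag (n : ℕ) : Type := Fin n

/-- The zig-zag order `a₁ ≺ a₂ ≻ a₃ ≺ ⋯`: with indices starting at `0`, every element of even
index lies below its neighbours, and there are no other strict relations. -/
instance ZigZag.instPartialOrder (n : ℕ) : PartialOrder (ZigZag n) where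
  le a b := a = b ∨ (a.val % 2 = 0 ∧ (b.val = a.val + 1 ∨ a.val = b.val + 1))
  le_refl a := Or.inl rfl
  le_trans a b c := by
    rintro (rfl | ⟨h1, h2⟩) (rfl | ⟨h3, h4⟩)
    · exact Or.inl rfl
    · exact Or.inr ⟨h3, h4⟩
    · exact Or.inr ⟨h1, h2⟩
    · omega
  le_antisymm a b := by
    rintro (rfl | ⟨h1, h2⟩) (h | ⟨h3, h4⟩)
    · rfl
    · rfl
    · exact h.symm
    · omega

/-- The polytope `P_n ⊆ ℝⁿ` given by `0 ≤ x_i ≤ 1` for all `i` and `x_i + x_{i+1} ≤ 1` for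
consecutive coordinates. For `n ≥ 2` the bounds `x_i ≤ 1` follow from the other inequalities; for
`n = 1`, where there are no pairs of consecutive coordinates, they make `P_1 = [0, 1]`. -/
def zigzagPolytope (n : ℕ) : Set (Fin n → ℝ) :=
  {x | (∀ i, 0 ≤ x i) ∧ (∀ i, x i ≤ 1) ∧ ∀ i j : Fin n, j.val = i.val + 1 → x i + x j ≤ 1}

/-- For `n ≥ 2` the upper bounds `x_i ≤ 1` are redundant. -/
theorem mem_zigzagPolytope_iff {n : ℕ} (hn : 2 ≤ n) (x : Fin n → ℝ) :
    x ∈ zigzagPolytope n ↔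
      (∀ i, 0 ≤ x i) ∧ ∀ i j : Fin n, j.val = i.val + 1 → x i + x j ≤ 1 := by
  refine ⟨fun h => ⟨h.1, h.2.2⟩, fun h => ⟨h.1, fun i => ?_, h.2⟩⟩
  by_cases hi : i.val + 1 < n
  · have h1 := h.2 i ⟨i.val + 1, hi⟩ rfl
    have h2 := h.1 ⟨i.val + 1, hi⟩
    linarith
  · have hlt := i.isLt
    have h1 := h.2 ⟨i.val - 1, by omega⟩ i (by simp only; omega)
    have h2 := h.1 ⟨i.val - 1, by omega⟩
    linarith

/-!
Complementing the coordinates of odd index (counted from `0`) identifies the lattice points of the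
`k`-th dilate of the polytope with the order-preserving maps from the zig-zag poset to
`{0, …, k}`. This poset has rank one: its elements are low or high, and for `n ≥ 2` none is isolated.

Split these maps according to the set of pairs (low `l`, high `h`) with `f l ≤ f h`. Knowing all
these comparisons turns the poset into an ordinal sum of antichains
`B₁ ≤ B₂ < B₃ ≤ B₄ < ⋯ ≤ B₂ⱼ`, alternately low and high, with weak inequalities from low to high
blocks and strict ones from high to low blocks. Since no element is isolated, the bottom block is
low and the top block is high (`exists_numerator_sameComparisons`). The generating function of an
ordinal sum is a product (`boundedSeries_ordinalSum`), so the class contributes to the numerator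
the term `X ^ (j - 1) * ∏ A(bᵢ)`, where `A(b)` is the Eulerian polynomial of degree `b - 1` and
`bᵢ` is the size of `Bᵢ`.

Eulerian polynomials are `γ`-nonnegative, that is, nonnegative combinations of the polynomials
`X ^ i * (1 + X) ^ j` with `2 * i + j` fixed (`exists_eulerian`), and this property passes to
products. The value of this invariant for the term above is
`2 * (j - 1) + ∑ (bᵢ - 1) = n - 2`, whatever the class is. Hence the whole numerator is `γ`-nonnegative with the single centre of
symmetry `(n - 2) / 2`, and so it is unimodal (`isUnimodal_of_mem_gammaCone`). The decomposition
is an instance of the one by which Brändén treats sign-graded posets. For `n = 1` the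
numerator is `A(1) = 1`.
-/

/-! ### `γ`-nonnegative polynomials -/

section GammaCone

open Polynomial

/-- The cone of polynomials that are nonnegative integer combinations of the polynomials
`X ^ i * (1 + X) ^ j` with `2 * i + j = d`; these are the `γ`-nonnegative polynomials with centre of
symmetry `d / 2`. -/
noncomputable def gammaCone (d : ℕ) : AddSubmonoid ℤ[X] :=
  AddSubmonoid.closure {p | ∃ i j : ℕ, 2 * i + j = d ∧ p = X ^ i * (1 + X) ^ j}

theorem basis_mem_gammaCone {d : ℕ} (i j : ℕ) (h : 2 * i + j = d) :
    (X ^ i * (1 + X) ^ j : ℤ[X]) ∈ gammaCone d :=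
  AddSubmonoid.subset_closure ⟨i, j, h, rfl⟩

theorem gammaCone_mul {d e : ℕ} {p q : ℤ[X]} (hp : p ∈ gammaCone d) (hq : q ∈ gammaCone e) :
    p * q ∈ gammaCone (d + e) := by
  induction hp using AddSubmonoid.closure_induction with
  | zero => simp
  | add x y _ _ hx hy => rw [add_mul]; exact add_mem hx hy
  | mem x hx =>
    induction hq using AddSubmonoid.closure_induction with
    | zero => simp
    | add y z _ _ hy hz => rw [mul_add]; exact add_mem hy hz
    | mem y hy =>
      obtain ⟨i, j, hij, rfl⟩ := hx
      obtain ⟨k, l, hkl, rfl⟩ := hy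
      have : (X ^ i * (1 + X) ^ j * (X ^ k * (1 + X) ^ l) : ℤ[X])
          = X ^ (i + k) * (1 + X) ^ (j + l) := by ring
      rw [this]
      exact basis_mem_gammaCone _ _ (by omega)

theorem X_mem_gammaCone : (X : ℤ[X]) ∈ gammaCone 2 := by
  simpa using basis_mem_gammaCone 1 0 rfl

/-- The recursion of the Eulerian polynomials preserves `γ`-nonnegativity. -/
theorem eulerian_step_mem_gammaCone {d : ℕ} {p : ℤ[X]} (hp : p ∈ gammaCone d) :
    (1 + ((d : ℤ[X]) + 1) * X) * p + X * (1 - X) * derivative p ∈ gammaCone (d + 1) := by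
  induction hp using AddSubmonoid.closure_induction with
  | zero => simp
  | add x y _ _ hx hy =>
    convert add_mem hx hy using 1
    rw [derivative_add]
    ring
  | mem x hx =>
    obtain ⟨i, j, rfl, rfl⟩ := hx
    have hX : (X : ℤ[X]) * derivative (X ^ i : ℤ[X]) = (i : ℤ[X]) * X ^ i := by
      rcases i with _ | i
      · simp
      · rw [derivative_X_pow]
        simp only [Nat.add_sub_cancel, C_eq_natCast]
        ring
    rcases j with _ | j
    · have : (1 + (((2 * i + 0 : ℕ) : ℤ[X]) + 1) * X) * (X ^ i * (1 + X) ^ 0)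
          + X * (1 - X) * derivative (X ^ i * (1 + X) ^ 0 : ℤ[X])
          = (i + 1) • (X ^ i * (1 + X) ^ 1 : ℤ[X]) := by
        rw [pow_zero, mul_one, nsmul_eq_mul]
        push_cast
        linear_combination (1 - X) * hX
      rw [this]
      exact nsmul_mem (basis_mem_gammaCone _ _ (by omega)) _
    · have : (1 + (((2 * i + (j + 1) : ℕ) : ℤ[X]) + 1) * X) * (X ^ i * (1 + X) ^ (j + 1))
          + X * (1 - X) * derivative (X ^ i * (1 + X) ^ (j + 1) : ℤ[X])
          = (i + 1) • (X ^ i * (1 + X) ^ (j + 2) : ℤ[X])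
            + (2 * (j + 1)) • (X ^ (i + 1) * (1 + X) ^ j : ℤ[X]) := by
        have h1 : derivative ((1 + X) ^ (j + 1) : ℤ[X]) = ((j : ℤ[X]) + 1) * (1 + X) ^ j := by
          rw [derivative_pow]
          simp
        rw [derivative_mul, h1, nsmul_eq_mul, nsmul_eq_mul]
        push_cast
        linear_combination (1 - X) * (1 + X) ^ (j + 1) * hX
      rw [this]
      exact add_mem (nsmul_mem (basis_mem_gammaCone _ _ (by omega)) _)
        (nsmul_mem (basis_mem_gammaCone _ _ (by omega)) _)

theorem coeff_X_pow_mul_one_add_X_pow (i j m : ℕ) :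
    (X ^ i * (1 + X) ^ j : ℤ[X]).coeff m = if i ≤ m then (j.choose (m - i) : ℤ) else 0 := by
  rw [coeff_X_pow_mul', coeff_one_add_X_pow]

theorem coeff_le_coeff_succ_of_mem_gammaCone {d : ℕ} {p : ℤ[X]} (hp : p ∈ gammaCone d) {m : ℕ}
    (hm : 2 * m < d) : p.coeff m ≤ p.coeff (m + 1) := by
  induction hp using AddSubmonoid.closure_induction with
  | zero => simp
  | add x y _ _ hx hy => rw [coeff_add, coeff_add]; exact add_le_add hx hy
  | mem x hx =>
    obtain ⟨i, j, hij, rfl⟩ := hx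
    rw [coeff_X_pow_mul_one_add_X_pow, coeff_X_pow_mul_one_add_X_pow]
    by_cases h : i ≤ m
    · rw [if_pos h, if_pos (by omega), Nat.succ_sub h]
      norm_cast
      by_cases h2 : m - i < j / 2
      · exact Nat.choose_le_succ_of_lt_half_left h2
      · have h3 : j = (m - i) + (m - i + 1) := by omega
        exact (Nat.choose_symm_of_eq_add h3).le
    · rw [if_neg h]
      split_ifs <;> positivity

theorem coeff_succ_le_coeff_of_mem_gammaCone {d : ℕ} {p : ℤ[X]} (hp : p ∈ gammaCone d) {m : ℕ}
    (hm : d ≤ 2 * m + 1) : p.coeff (m + 1) ≤ p.coeff m := by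
  induction hp using AddSubmonoid.closure_induction with
  | zero => simp
  | add x y _ _ hx hy => rw [coeff_add, coeff_add]; exact add_le_add hx hy
  | mem x hx =>
    obtain ⟨i, j, hij, rfl⟩ := hx
    rw [coeff_X_pow_mul_one_add_X_pow, coeff_X_pow_mul_one_add_X_pow]
    by_cases h : i ≤ m
    · rw [if_pos h, if_pos (by omega), Nat.succ_sub h]
      norm_cast
      rw [← Nat.mul_le_mul_right_iff (Nat.succ_pos (m - i)), Nat.succ_eq_add_one,
        Nat.choose_succ_right_eq]
      exact Nat.mul_le_mul_left _ (by omega)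
    · -- `2 * i ≤ d ≤ 2 * m + 1` forces `i ≤ m`
      omega

theorem natDegree_le_of_mem_gammaCone {d : ℕ} {p : ℤ[X]} (hp : p ∈ gammaCone d) :
    p.natDegree ≤ d := by
  induction hp using AddSubmonoid.closure_induction with
  | zero => simp
  | add x y _ _ hx hy => exact natDegree_add_le_of_degree_le hx hy
  | mem x hx =>
    obtain ⟨i, j, hij, rfl⟩ := hx
    rw [natDegree_le_iff_coeff_eq_zero]
    intro m hm
    rw [coeff_X_pow_mul_one_add_X_pow, if_pos (by omega), Nat.choose_eq_zero_of_lt (by omega)]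
    rfl

theorem isUnimodal_of_mem_gammaCone {d : ℕ} {p : ℤ[X]} (hp : p ∈ gammaCone d) :
    IsUnimodal p := by
  refine ⟨min (d / 2) p.natDegree, min_le_right _ _, fun m hm => ?_, fun m hm hm' => ?_⟩
  · exact coeff_le_coeff_succ_of_mem_gammaCone hp (by omega)
  · exact coeff_succ_le_coeff_of_mem_gammaCone hp (by omega)

end GammaCone

/-! ### Counting bounded functions; ordinal sums -/

section Counting

open Finset

variable {ι : Type} [Fintype ι]

open Classical in
/-- The functions in `S` with values in `{0, …, k}`. -/
noncomputable def boundedPart (S : Set (ι → ℕ)) (k : ℕ) : Finset (ι → ℕ) :=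
  (Fintype.piFinset fun _ => range (k + 1)).filter (· ∈ S)

theorem mem_boundedPart {S : Set (ι → ℕ)} {k : ℕ} {f : ι → ℕ} :
    f ∈ boundedPart S k ↔ (∀ i, f i ≤ k) ∧ f ∈ S := by
  simp [boundedPart]

/-- The generating function `∑ |{f ∈ S : f ≤ k}| X ^ k`. -/
noncomputable def boundedSeries (S : Set (ι → ℕ)) : PowerSeries ℤ :=
  PowerSeries.mk fun k => (#(boundedPart S k) : ℤ)

theorem card_boundedPart_univ (k : ℕ) :
    #(boundedPart (Set.univ : Set (ι → ℕ)) k) = (k + 1) ^ Fintype.card ι := by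
  classical
  have : boundedPart (Set.univ : Set (ι → ℕ)) k = Fintype.piFinset fun _ => range (k + 1) := by
    ext f
    simp [mem_boundedPart]
  rw [this, Fintype.card_piFinset]
  simp

theorem univ_sup_le_iff {k : ℕ} {f : ι → ℕ} : univ.sup f ≤ k ↔ ∀ i, f i ≤ k := by
  simp [Finset.sup_le_iff]

/-- Multiplying by `1 - X` turns the count of functions bounded by `k` into the count of functions
with maximum exactly `k`. -/
theorem coeff_one_sub_X_mul_boundedSeries (S : Set (ι → ℕ)) (k : ℕ) :
    PowerSeries.coeff k ((1 - PowerSeries.X) * boundedSeries S)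
      = (#((boundedPart S k).filter fun f => univ.sup f = k) : ℤ) := by
  rw [sub_mul, one_mul, map_sub, boundedSeries]
  rcases k with _ | k
  · rw [PowerSeries.coeff_zero_X_mul, sub_zero, PowerSeries.coeff_mk, filter_true_of_mem]
    intro f hf
    exact Nat.le_zero.1 (univ_sup_le_iff.2 (mem_boundedPart.1 hf).1)
  · rw [PowerSeries.coeff_succ_X_mul, PowerSeries.coeff_mk, PowerSeries.coeff_mk,
      sub_eq_iff_eq_add, ← card_filter_add_card_filter_not (fun f => univ.sup f = k + 1)]
    push_cast
    congr 3
    ext f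
    rw [mem_filter, mem_boundedPart, mem_boundedPart, ← univ_sup_le_iff, ← univ_sup_le_iff]
    constructor
    · rintro ⟨⟨h1, h2⟩, h3⟩
      exact ⟨by omega, h2⟩
    · rintro ⟨h1, h2⟩
      exact ⟨⟨by omega, h2⟩, by omega⟩

/-- The functions on `ι` whose restriction to the complement of `p` lies in `T` and whose values
there exceed the values on `p` by at least `s`. For `T` a set of order-preserving maps this is the
ordinal sum of an antichain and a poset. -/
def ordinalSum (p : ι → Prop) (s : ℕ) (T : Set ({i // ¬p i} → ℕ)) : Set (ι → ℕ) :=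
  {f | (∀ i j, p i → ¬p j → f i + s ≤ f j) ∧ (fun j : {i // ¬p i} => f j) ∈ T}

open Classical in
/-- For a translation-invariant `T`, members with values in `{a, …, k}` correspond to members with
values in `{0, …, k - a}`. For `a > k` there are none, since the domain is nonempty. -/
theorem card_translate {κ : Type} [Fintype κ] [Nonempty κ] (T : Set (κ → ℕ))
    (hT : ∀ g c, (fun j => g j + c) ∈ T ↔ g ∈ T) (a k : ℕ) :
    #((boundedPart T k).filter fun g => ∀ j, a ≤ g j)
      = if a ≤ k then #(boundedPart T (k - a)) else 0 := by
  split_ifs with h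
  · symm
    refine card_bij (fun g _ j => g j + a) ?_ ?_ ?_
    · intro g hg
      rw [mem_boundedPart] at hg
      rw [mem_filter, mem_boundedPart, hT]
      exact ⟨⟨fun j => by have := hg.1 j; omega, hg.2⟩, fun j => Nat.le_add_left _ _⟩
    · intro g _ g' _ hgg
      funext j
      have := congrFun hgg j
      simpa using this
    · intro g hg
      rw [mem_filter, mem_boundedPart] at hg
      obtain ⟨⟨h1, h2⟩, h3⟩ := hg
      have h4 : (fun j => g j - a + a) = g := funext fun j => Nat.sub_add_cancel (h3 j)
      refine ⟨fun j => g j - a, ?_, h4⟩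
      rw [mem_boundedPart]
      refine ⟨fun j => by have := h1 j; omega, ?_⟩
      rw [← hT _ a, h4]
      exact h2
  · rw [card_eq_zero, filter_eq_empty_iff]
    intro g hg hg'
    obtain ⟨j⟩ := ‹Nonempty κ›
    have := (mem_boundedPart.1 hg).1 j
    exact h ((hg' j).trans this)

open Classical in
/-- The functions in an ordinal sum whose restriction to the bottom antichain has maximum `m`. -/
theorem card_ordinalSum_fiber (p : ι → Prop) (s : ℕ) [Fintype {i // p i}]
    [Fintype {i // ¬p i}] [Nonempty {i // p i}]
    (T : Set ({i // ¬p i} → ℕ)) {m k : ℕ} (hm : m ≤ k) :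
    #((boundedPart (ordinalSum p s T) k).filter
        fun f => univ.sup (fun i : {i // p i} => f i) = m)
      = #((boundedPart (Set.univ : Set ({i // p i} → ℕ)) m).filter fun u => univ.sup u = m)
        * #((boundedPart T k).filter fun g => ∀ j, m + s ≤ g j) := by
  rw [← card_product]
  refine card_equiv (Equiv.piEquivPiSubtypeProd p fun _ => ℕ) fun f => ?_
  simp only [mem_filter, mem_product, mem_boundedPart, Equiv.piEquivPiSubtypeProd_apply,
    Set.mem_univ, and_true, ordinalSum, Set.mem_ofPred_eq]
  constructor
  · rintro ⟨⟨h1, h2, h3⟩, h4⟩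
    refine ⟨⟨univ_sup_le_iff.1 h4.le, h4⟩, ⟨fun j => h1 j, h3⟩, fun j => ?_⟩
    obtain ⟨i, -, hi⟩ := exists_mem_eq_sup (univ : Finset {i // p i}) univ_nonempty
      (fun i : {i // p i} => f i)
    have := h2 i j i.2 j.2
    omega
  · rintro ⟨⟨h1, h2⟩, ⟨h3, h4⟩, h5⟩
    refine ⟨⟨fun i => ?_, fun i j hi hj => ?_, h4⟩, h2⟩
    · by_cases hi : p i
      · exact (h1 ⟨i, hi⟩).trans hm
      · exact h3 ⟨i, hi⟩
    · have h6 := h1 ⟨i, hi⟩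
      have h7 := h5 ⟨j, hj⟩
      simp only at h6 h7
      omega

open Classical in
/-- The generating function of an ordinal sum is a product. -/
theorem boundedSeries_ordinalSum (p : ι → Prop) (s : ℕ) [Fintype {i // p i}]
    [Fintype {i // ¬p i}] [Nonempty {i // p i}] [Nonempty {i // ¬p i}] (T : Set ({i // ¬p i} → ℕ))
    (hT : ∀ g c, (fun j => g j + c) ∈ T ↔ g ∈ T) :
    boundedSeries (ordinalSum p s T)
      = (1 - PowerSeries.X) * boundedSeries (Set.univ : Set ({i // p i} → ℕ))
        * (PowerSeries.X ^ s * boundedSeries T) := by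
  ext k
  rw [PowerSeries.coeff_mul, Nat.sum_antidiagonal_eq_sum_range_succ_mk, boundedSeries,
    PowerSeries.coeff_mk,
    card_eq_sum_card_fiberwise (f := fun f => univ.sup (fun i : {i // p i} => f i))
      (t := range (k + 1)), Nat.cast_sum]
  · refine sum_congr rfl fun m hm => ?_
    have hm' : m ≤ k := Nat.lt_succ_iff.1 (mem_range.1 hm)
    rw [coeff_one_sub_X_mul_boundedSeries, PowerSeries.coeff_X_pow_mul',
      card_ordinalSum_fiber p s T hm', card_translate T hT, boundedSeries, Nat.cast_mul]
    congr 1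
    by_cases h : m + s ≤ k
    · rw [if_pos h, if_pos (by omega), PowerSeries.coeff_mk, Nat.sub_sub]
    · rw [if_neg h, if_neg (by omega), Nat.cast_zero]
  · intro f hf
    simp only [coe_range, Set.mem_Iio, Nat.lt_succ_iff]
    exact univ_sup_le_iff.2 fun i => (mem_boundedPart.1 hf).1 i

/-- The Eulerian polynomial: the generating function of all functions on a set with `d + 1`
elements has a `γ`-nonnegative numerator. -/
theorem exists_eulerian (d : ℕ) : ∃ p ∈ gammaCone d,
    PowerSeries.mk (fun k => ((k : ℤ) + 1) ^ (d + 1)) * (1 - PowerSeries.X) ^ (d + 2)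
      = (p : PowerSeries ℤ) := by
  induction d with
  | zero =>
    refine ⟨1, by simpa using basis_mem_gammaCone 0 0 rfl, ?_⟩
    have h := PowerSeries.mk_add_choose_mul_one_sub_pow_eq_one ℤ 1
    simp only [Nat.choose_one_right, Nat.cast_add, Nat.cast_one] at h
    simpa [add_comm] using h
  | succ d ih =>
    obtain ⟨p, hp, h⟩ := ih
    refine ⟨_, eulerian_step_mem_gammaCone hp, ?_⟩
    set F : PowerSeries ℤ := PowerSeries.mk fun k => ((k : ℤ) + 1) ^ (d + 1) with hF
    have h1 : PowerSeries.mk (fun k => ((k : ℤ) + 1) ^ (d + 1 + 1))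
        = F + PowerSeries.X * PowerSeries.derivative ℤ F := by
      ext k
      rw [map_add, PowerSeries.coeff_mk, hF, PowerSeries.coeff_mk]
      rcases k with _ | k
      · simp
      · rw [PowerSeries.coeff_succ_X_mul, PowerSeries.coeff_derivative, PowerSeries.coeff_mk]
        push_cast
        ring
    have h2 := congrArg (PowerSeries.derivative ℤ) h
    rw [PowerSeries.derivative_coe, Derivation.leibniz, PowerSeries.derivative_pow] at h2
    simp only [map_sub, PowerSeries.derivative_one, PowerSeries.derivative_X, smul_eq_mul] at h2
    rw [h1]
    push_cast
    have hd : ((d : ℤ[X]) : PowerSeries ℤ) = d :=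
      map_natCast (Polynomial.coeToPowerSeries.ringHom (R := ℤ)) d
    rw [← h, ← h2, hd]
    push_cast
    ring

end Counting

/-! ### Posets of rank one -/

section RankOne

open Finset

theorem boundedSeries_univ {ι : Type} [Fintype ι] :
    boundedSeries (Set.univ : Set (ι → ℕ))
      = PowerSeries.mk fun k => ((k : ℤ) + 1) ^ Fintype.card ι := by
  ext k
  rw [boundedSeries, PowerSeries.coeff_mk, PowerSeries.coeff_mk, card_boundedPart_univ]
  push_cast
  rfl

theorem exists_numerator_univ (ι : Type) [Fintype ι] [Nonempty ι] :
    ∃ d, d + 1 = Fintype.card ι ∧ ∃ p ∈ gammaCone d,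
      boundedSeries (Set.univ : Set (ι → ℕ)) * (1 - PowerSeries.X) ^ (Fintype.card ι + 1)
        = (p : PowerSeries ℤ) := by
  obtain ⟨d, hd⟩ := Nat.exists_eq_succ_of_ne_zero (Fintype.card_ne_zero (α := ι))
  obtain ⟨p, hp, h⟩ := exists_eulerian d
  exact ⟨d, hd.symm, p, hp, by rw [boundedSeries_univ, hd]; exact h⟩

/-- The functions which compare low elements with high elements in the same way as `f₀` does. -/
def sameComparisons {ι : Type} (low : ι → Prop) (f₀ : ι → ℕ) : Set (ι → ℕ) :=
  {f | ∀ l h, low l → ¬low h → (f l ≤ f h ↔ f₀ l ≤ f₀ h)}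

theorem translate_mem_sameComparisons {ι : Type} (low : ι → Prop) (f₀ f : ι → ℕ) (c : ℕ) :
    (fun j => f j + c) ∈ sameComparisons low f₀ ↔ f ∈ sameComparisons low f₀ := by
  simp [sameComparisons]

/-- The low elements below all high elements form the bottom block of an ordinal sum. -/
theorem sameComparisons_eq_ordinalSum_low {ι : Type} (low : ι → Prop) (f₀ : ι → ℕ) :
    sameComparisons low f₀
      = ordinalSum (fun i => low i ∧ ∀ h, ¬low h → f₀ i ≤ f₀ h) 0
          (sameComparisons (fun j => low j) fun j => f₀ j) := by
  ext f
  constructor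
  · refine fun hf => ⟨fun i j hi hj => ?_, fun l h hl hh => hf l h hl hh⟩
    by_cases hlj : low j
    · obtain ⟨h, hh, hjh⟩ : ∃ h, ¬low h ∧ ¬f₀ j ≤ f₀ h := by
        by_contra! hc
        exact hj ⟨hlj, hc⟩
      have h1 := (hf j h hlj hh).not.2 hjh
      have h2 := (hf i h hi.1 hh).2 (hi.2 h hh)
      omega
    · exact (hf i j hi.1 hlj).2 (hi.2 j hlj)
  · rintro ⟨hf, hr⟩ l h hl hh
    by_cases hlB : low l ∧ ∀ h, ¬low h → f₀ l ≤ f₀ h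
    · exact iff_of_true (hf l h hlB fun hhB => hh hhB.1) (hlB.2 h hh)
    · exact hr ⟨l, hlB⟩ ⟨h, fun hhB => hh hhB.1⟩ hl hh

/-- The high elements strictly below all low elements form the bottom block of an ordinal sum. -/
theorem sameComparisons_eq_ordinalSum_high {ι : Type} (low : ι → Prop) (f₀ : ι → ℕ) :
    sameComparisons low f₀
      = ordinalSum (fun i => ¬low i ∧ ∀ l, low l → f₀ i < f₀ l) 1
          (sameComparisons (fun j => low j) fun j => f₀ j) := by
  ext f
  constructor
  · refine fun hf => ⟨fun i j hi hj => ?_, fun l h hl hh => hf l h hl hh⟩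
    by_cases hlj : low j
    · exact not_le.1 ((hf j i hlj hi.1).not.2 (not_le.2 (hi.2 j hlj)))
    · obtain ⟨l, hl, hlh⟩ : ∃ l, low l ∧ ¬f₀ j < f₀ l := by
        by_contra! hc
        exact hj ⟨hlj, hc⟩
      have h1 := (hf l i hl hi.1).not.2 (not_le.2 (hi.2 l hl))
      have h2 := (hf l j hl hlj).2 (not_lt.1 hlh)
      omega
  · rintro ⟨hf, hr⟩ l h hl hh
    by_cases hhC : ¬low h ∧ ∀ l, low l → f₀ h < f₀ l
    · have h1 := hf h l hhC fun hlC => hlC.1 hl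
      exact iff_of_false (by omega) (not_le.2 (hhC.2 l hl))
    · exact hr ⟨l, fun hlC => hlC.1 hl⟩ ⟨h, hhC⟩ hl hh

open Classical in
/-- A class of functions with prescribed comparisons is an ordinal sum of antichains, alternately
low and high, beginning with a low and ending with a high one. Each pair of consecutive blocks
contributes two Eulerian polynomials and, when further blocks follow, a factor `X` from the strict
inequality; the centre of symmetry depends only on the number of elements. -/
theorem exists_numerator_sameComparisons (n : ℕ) :
    ∀ (ι : Type) [Fintype ι] [Nonempty ι] (low : ι → Prop) (f₀ : ι → ℕ),
      Fintype.card ι = n →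
      (∀ h, ¬low h → ∃ l, low l ∧ f₀ l ≤ f₀ h) →
      (∀ l, low l → ∃ h, ¬low h ∧ f₀ l ≤ f₀ h) →
      ∃ d, d + 2 = n ∧ ∃ p ∈ gammaCone d,
        boundedSeries (sameComparisons low f₀) * (1 - PowerSeries.X) ^ (n + 1)
          = (p : PowerSeries ℤ) := by
  induction n using Nat.strong_induction_on with
  | _ n ih =>
  intro ι _ _ low f₀ hn hhigh hlow
  obtain ⟨l₁, hl₁⟩ : ∃ l, low l := by
    obtain ⟨i⟩ := ‹Nonempty ι›
    by_cases hi : low i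
    · exact ⟨i, hi⟩
    · obtain ⟨l, hl, -⟩ := hhigh i hi
      exact ⟨l, hl⟩
  obtain ⟨h₁, hh₁, -⟩ := hlow l₁ hl₁
  obtain ⟨l₀, hl₀, hl₀min⟩ := exists_min_image (univ.filter low) f₀ ⟨l₁, by simpa using hl₁⟩
  obtain ⟨h₀, hh₀, hh₀min⟩ :=
    exists_min_image (univ.filter fun h => ¬low h) f₀ ⟨h₁, by simpa using hh₁⟩
  simp only [mem_filter, mem_univ, true_and] at hl₀ hl₀min hh₀ hh₀min
  -- the bottom block; it contains every low element at which `f₀` is minimal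
  set B : ι → Prop := fun i => low i ∧ ∀ h, ¬low h → f₀ i ≤ f₀ h
  have : Nonempty {i // B i} := by
    refine ⟨l₀, hl₀, fun h hh => ?_⟩
    obtain ⟨l, hl, hlh⟩ := hhigh h hh
    exact (hl₀min l hl).trans hlh
  have hBhigh : ∀ h, ¬low h → ¬B h := fun h hh hhB => hh hhB.1
  have : Nonempty {i // ¬B i} := ⟨h₀, hBhigh h₀ hh₀⟩
  obtain ⟨b, hb, pB, hpB, hsB⟩ := exists_numerator_univ {i // B i}
  have hcard := Fintype.card_subtype_compl B
  have hle := Fintype.card_subtype_le B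
  have hsum := boundedSeries_ordinalSum B 0 _
    (fun g c => translate_mem_sameComparisons (fun j : {i // ¬B i} => low j) (fun j => f₀ j) g c)
  rw [← sameComparisons_eq_ordinalSum_low low f₀, pow_zero, one_mul] at hsum
  rw [hsum]
  by_cases hrest : ∃ j : {i // ¬B i}, low j
  · obtain ⟨j₀, hj₀⟩ := hrest
    -- the second block; it contains every high element at which `f₀` is minimal
    set C : {i // ¬B i} → Prop := fun i => ¬low i ∧ ∀ l : {i // ¬B i}, low l → f₀ i < f₀ l
    have : Nonempty {i // C i} := by
      refine ⟨⟨h₀, hBhigh h₀ hh₀⟩, hh₀, fun l hl => ?_⟩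
      obtain ⟨h, hh, hlh⟩ : ∃ h, ¬low h ∧ ¬f₀ l ≤ f₀ h := by
        by_contra! hc
        exact l.2 ⟨hl, hc⟩
      exact (hh₀min h hh).trans_lt (not_le.1 hlh)
    have hClow : ∀ l : {i // ¬B i}, low l → ¬C l := fun l hl hlC => hlC.1 hl
    have : Nonempty {i // ¬C i} := ⟨j₀, hClow j₀ hj₀⟩
    obtain ⟨c, hc, pC, hpC, hsC⟩ := exists_numerator_univ {i // C i}
    have hcardC := Fintype.card_subtype_compl C
    have hleC := Fintype.card_subtype_le C
    have hsumC := boundedSeries_ordinalSum C 1 _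
      (fun g c => translate_mem_sameComparisons (fun j : {i // ¬C i} => low j) (fun j => f₀ j) g c)
    rw [← sameComparisons_eq_ordinalSum_high (fun j : {i // ¬B i} => low j) (fun j => f₀ j),
      pow_one] at hsumC
    obtain ⟨e, he, p, hp, hs⟩ := ih (Fintype.card {i // ¬C i}) (by omega) {i // ¬C i}
      (fun j => low j) (fun j => f₀ j) rfl
      (fun h hh => by
        obtain ⟨l, hl, hlh⟩ : ∃ l : {i // ¬B i}, low l ∧ ¬f₀ h < f₀ l := by
          by_contra! hc
          exact h.2 ⟨hh, hc⟩
        exact ⟨⟨l, hClow l hl⟩, hl, not_lt.1 hlh⟩)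
      (fun l hl => by
        obtain ⟨h, hh, hlh⟩ := hlow l hl
        exact ⟨⟨⟨h, hBhigh h hh⟩, fun hhC => absurd (hhC.2 l hl) (not_lt.2 hlh)⟩, hh, hlh⟩)
    refine ⟨b + 2 + c + e, by omega, pB * Polynomial.X * pC * p,
      gammaCone_mul (gammaCone_mul (gammaCone_mul hpB X_mem_gammaCone) hpC) hp, ?_⟩
    have hn' : n = Fintype.card {i // B i} + Fintype.card {i // C i}
        + Fintype.card {i // ¬C i} := by omega
    rw [hsumC, hn']
    push_cast
    rw [← hsB, ← hsC, ← hs]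
    ring
  · -- no low element is left above `B`, so the rest is a single antichain
    have huniv : sameComparisons (fun j : {i // ¬B i} => low j) (fun j => f₀ j) = Set.univ :=
      Set.eq_univ_of_forall fun f l h hl => absurd ⟨l, hl⟩ hrest
    obtain ⟨c, hc, pC, hpC, hsC⟩ := exists_numerator_univ {i // ¬B i}
    refine ⟨b + c, by omega, pB * pC, gammaCone_mul hpB hpC, ?_⟩
    have hn' : n = Fintype.card {i // B i} + Fintype.card {i // ¬B i} := by omega
    rw [huniv, hn']
    push_cast
    rw [← hsB, ← hsC]
    ring

open Classical in
/-- For a poset of rank one without isolated elements, the generating function of order-preserving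
maps has a `γ`-nonnegative numerator: it is a sum over the possible comparisons between low and
high elements. -/
theorem exists_numerator_rankOne (ι : Type) [Fintype ι] [Nonempty ι] (low : ι → Prop)
    (r : ι → ι → Prop) (hr : ∀ l h, r l h → low l ∧ ¬low h)
    (hhigh : ∀ h, ¬low h → ∃ l, r l h) (hlow : ∀ l, low l → ∃ h, r l h) :
    ∃ d, d + 2 = Fintype.card ι ∧ ∃ p ∈ gammaCone d,
      boundedSeries {f : ι → ℕ | ∀ l h, r l h → f l ≤ f h}
        * (1 - PowerSeries.X) ^ (Fintype.card ι + 1) = (p : PowerSeries ℤ) := by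
  set S : Set (ι → ℕ) := {f : ι → ℕ | ∀ l h, r l h → f l ≤ f h}
  -- the set of comparisons satisfied by a function
  let rel : (ι → ℕ) → Finset (ι × ι) := fun f =>
    univ.filter fun x => low x.1 ∧ ¬low x.2 ∧ f x.1 ≤ f x.2
  have hrel : ∀ f f₀, rel f = rel f₀ ↔ f ∈ sameComparisons low f₀ := by
    intro f f₀
    simp only [rel, Finset.ext_iff, mem_filter, mem_univ, true_and, Prod.forall, sameComparisons,
      Set.mem_ofPred_eq]
    exact forall_congr' fun l => forall_congr' fun h => by tauto
  have hsum : boundedSeries S = ∑ R : Finset (ι × ι), boundedSeries {f ∈ S | rel f = R} := by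
    ext k
    simp only [map_sum, boundedSeries, PowerSeries.coeff_mk]
    rw [card_eq_sum_card_fiberwise (f := rel) (t := univ) (fun _ _ => mem_coe.2 (mem_univ _)),
      Nat.cast_sum]
    refine sum_congr rfl fun R _ => ?_
    congr 2
    ext f
    simp [mem_boundedPart, and_assoc]
  have hcard : 2 ≤ Fintype.card ι := by
    obtain ⟨l, h, hlh⟩ : ∃ l h, r l h := by
      obtain ⟨i⟩ := ‹Nonempty ι›
      by_cases hi : low i
      · exact ⟨i, hlow i hi⟩
      · obtain ⟨l, hl⟩ := hhigh i hi
        exact ⟨l, i, hl⟩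
    refine Fintype.one_lt_card_iff.2 ⟨l, h, ?_⟩
    rintro rfl
    exact (hr l l hlh).2 (hr l l hlh).1
  obtain ⟨d, hd⟩ := Nat.exists_eq_add_of_le' hcard
  refine ⟨d, hd.symm, ?_⟩
  have hclass : ∀ R : Finset (ι × ι), ∃ p ∈ gammaCone d,
      boundedSeries {f ∈ S | rel f = R} * (1 - PowerSeries.X) ^ (Fintype.card ι + 1)
        = (p : PowerSeries ℤ) := by
    intro R
    by_cases hR : ∃ f₀ ∈ S, rel f₀ = R
    · obtain ⟨f₀, hf₀, rfl⟩ := hR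
      have heq : {f ∈ S | rel f = rel f₀} = sameComparisons low f₀ := by
        ext f
        refine ⟨fun hf => (hrel f f₀).1 hf.2, fun hf => ⟨fun l h hlh => ?_, (hrel f f₀).2 hf⟩⟩
        exact (hf l h (hr l h hlh).1 (hr l h hlh).2).2 (hf₀ l h hlh)
      obtain ⟨d', hd', p, hp, h⟩ := exists_numerator_sameComparisons _ ι low f₀ rfl
        (fun h hh => (hhigh h hh).imp fun l hl => ⟨(hr l h hl).1, hf₀ l h hl⟩)
        (fun l hl => (hlow l hl).imp fun h hh => ⟨(hr l h hh).2, hf₀ l h hh⟩)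
      obtain rfl : d' = d := by omega
      exact ⟨p, hp, by rw [heq, h]⟩
    · -- comparisons that no function satisfies contribute zero
      have heq : {f ∈ S | rel f = R} = ∅ :=
        Set.eq_empty_of_forall_notMem fun f hf => hR ⟨f, hf.1, hf.2⟩
      refine ⟨0, zero_mem _, ?_⟩
      have : boundedSeries (∅ : Set (ι → ℕ)) = 0 := by
        ext k
        simp [boundedSeries, boundedPart]
      rw [heq, this, zero_mul, Polynomial.coe_zero]
  choose p hp h using hclass
  refine ⟨∑ R, p R, sum_mem fun R _ => hp R, ?_⟩
  rw [hsum, sum_mul, sum_congr rfl fun R _ => h R]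
  exact (map_sum (Polynomial.coeToPowerSeries.ringHom (R := ℤ)) p univ).symm

end RankOne

/-! ### The zig-zag polytope -/

section Zigzag

theorem ZigZag.comparable_iff {n : ℕ} {a b : ZigZag n} (hab : a ≠ b) :
    a ≤ b ∨ b ≤ a ↔ b.val = a.val + 1 ∨ a.val = b.val + 1 := by
  constructor
  · rintro ((h | h) | (h | h))
    · exact absurd h hab
    · exact h.2
    · exact absurd h.symm hab
    · exact h.2.symm
  · intro h
    rcases Nat.mod_two_eq_zero_or_one a.val with ha | ha
    · exact Or.inl (Or.inr ⟨ha, h⟩)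
    · exact Or.inr (Or.inr ⟨by omega, h.symm⟩)

/-- The chains of the zig-zag poset are the subsets of pairs of neighbours. -/
theorem mem_chainPolytope_zigZag_iff {n : ℕ} (x : ZigZag n → ℝ) :
    x ∈ chainPolytope (ZigZag n) ↔ (∀ a, 0 ≤ x a) ∧ (∀ a, x a ≤ 1) ∧
      ∀ a b : ZigZag n, b.val = a.val + 1 → x a + x b ≤ 1 := by
  classical
  constructor
  · rintro ⟨h0, h1⟩
    refine ⟨h0, fun a => ?_, fun a b hab => ?_⟩
    · simpa using h1 {a} (by simp)
    · have hne : a ≠ b := by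
        rintro rfl
        omega
      have h2 := h1 {a, b} (by
        rw [Finset.coe_pair]
        rcases (ZigZag.comparable_iff hne).2 (Or.inl hab) with h | h
        · exact IsChain.pair h
        · rw [Set.pair_comm]
          exact IsChain.pair h)
      rwa [Finset.sum_pair hne] at h2
  · rintro ⟨h0, h1, h2⟩
    refine ⟨h0, fun s hs => ?_⟩
    have hadj : ∀ a ∈ s, ∀ b ∈ s, a ≠ b → b.val = a.val + 1 ∨ a.val = b.val + 1 :=
      fun a ha b hb hab => (ZigZag.comparable_iff hab).1 (hs ha hb hab)
    have hcard : s.card ≤ 2 := by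
      by_contra! hc
      obtain ⟨a, b, c, ha, hb, hc, hab, hac, hbc⟩ := Finset.two_lt_card_iff.1 hc
      -- the three differences of indices would be odd, although they sum to zero
      have h3 := hadj a ha b hb hab
      have h4 := hadj a ha c hc hac
      have h5 := hadj b hb c hc hbc
      omega
    obtain h | h | h : s.card = 0 ∨ s.card = 1 ∨ s.card = 2 := by omega
    · rw [Finset.card_eq_zero.1 h]
      simp
    · obtain ⟨a, rfl⟩ := Finset.card_eq_one.1 h
      rw [Finset.sum_singleton]
      exact h1 a
    · obtain ⟨a, b, hab, rfl⟩ := Finset.card_eq_two.1 h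
      rw [Finset.sum_pair hab]
      rcases hadj a (by simp) b (by simp) hab with h | h
      · exact h2 a b h
      · rw [add_comm]
        exact h2 b a h

theorem zigzagPolytope_eq_chainPolytope (n : ℕ) :
    zigzagPolytope n = chainPolytope (ZigZag n) :=
  Set.ext fun x => (mem_chainPolytope_zigZag_iff x).symm

theorem affineDim_zigzagPolytope (n : ℕ) : affineDim (zigzagPolytope n) = n := by
  have htop : vectorSpan ℝ (zigzagPolytope n) = ⊤ := by
    rw [eq_top_iff, ← (Pi.basisFun ℝ (Fin n)).span_eq, Submodule.span_le]
    rintro _ ⟨i, rfl⟩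
    rw [Pi.basisFun_apply]
    have h0 : (0 : Fin n → ℝ) ∈ zigzagPolytope n := by simp [zigzagPolytope]
    have h1 : (Pi.single i 1 : Fin n → ℝ) ∈ zigzagPolytope n := by
      refine ⟨fun j => ?_, fun j => ?_, fun j k hjk => ?_⟩
      · rw [Pi.single_apply]
        split_ifs <;> norm_num
      · rw [Pi.single_apply]
        split_ifs <;> norm_num
      · rw [Pi.single_apply, Pi.single_apply]
        split_ifs with h h'
        · subst h
          subst h'
          omega
        all_goals norm_num
    simpa using vsub_mem_vectorSpan ℝ h1 h0
  rw [affineDim, htop, finrank_top, Module.finrank_fin_fun]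

/-- Integer points of the dilates, described by integer inequalities; this includes `k = 0`. -/
theorem intCast_mem_smul_zigzagPolytope {n : ℕ} (k : ℕ) (z : Fin n → ℤ) :
    (fun i => (z i : ℝ)) ∈ (k : ℝ) • zigzagPolytope n ↔
      (∀ i, 0 ≤ z i) ∧ (∀ i, z i ≤ k) ∧ ∀ i j : Fin n, j.val = i.val + 1 → z i + z j ≤ k := by
  have hcast : ((∀ i, 0 ≤ z i) ∧ (∀ i, z i ≤ k) ∧
      ∀ i j : Fin n, j.val = i.val + 1 → z i + z j ≤ k) ↔
      (∀ i, (0 : ℝ) ≤ z i) ∧ (∀ i, (z i : ℝ) ≤ k) ∧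
      ∀ i j : Fin n, j.val = i.val + 1 → (z i : ℝ) + z j ≤ k := by
    norm_cast
  rw [hcast]
  constructor
  · rintro ⟨x, ⟨h0, h1, h2⟩, hx⟩
    have hz : ∀ i, (z i : ℝ) = k * x i := fun i => (congrFun hx i).symm
    have hk : (0 : ℝ) ≤ k := Nat.cast_nonneg k
    simp only [hz]
    refine ⟨fun i => mul_nonneg hk (h0 i), fun i => mul_le_of_le_one_right hk (h1 i),
      fun i j hij => ?_⟩
    rw [← mul_add]
    exact mul_le_of_le_one_right hk (h2 i j hij)
  · rintro ⟨h0, h1, h2⟩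
    rcases Nat.eq_zero_or_pos k with rfl | hk
    · refine ⟨0, by simp [zigzagPolytope], ?_⟩
      funext i
      have h3 := h0 i
      have h4 := h1 i
      simp only [Nat.cast_zero] at h4
      simp [le_antisymm h4 h3]
    · have hk' : (0 : ℝ) < k := Nat.cast_pos.2 hk
      refine ⟨fun i => z i / k, ⟨fun i => div_nonneg (h0 i) hk'.le,
        fun i => (div_le_one hk').2 (h1 i), fun i j hij => ?_⟩, ?_⟩
      · rw [← add_div]
        exact (div_le_one hk').2 (h2 i j hij)
      · funext i
        simp only [Pi.smul_apply, smul_eq_mul]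
        field_simp

/-- The cover relations of the zig-zag poset: `l` has even index and `h` is a neighbour of `l`. -/
def zigzagCover (n : ℕ) (l h : Fin n) : Prop :=
  l.val % 2 = 0 ∧ (h.val = l.val + 1 ∨ l.val = h.val + 1)

/-- The order-preserving maps from the zig-zag poset to `ℕ`. -/
def zigzagMaps (n : ℕ) : Set (Fin n → ℕ) :=
  {f | ∀ l h, zigzagCover n l h → f l ≤ f h}

/-- Complementing the coordinates of odd index turns order-preserving maps into `{0, …, k}` into
lattice points of the `k`-th dilate. -/
def zigzagTransfer (n k : ℕ) (f : Fin n → ℕ) (i : Fin n) : ℤ :=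
  if i.val % 2 = 0 then (f i : ℤ) else k - f i

theorem latticePoints_eq_image (n k : ℕ) :
    {z : Fin n → ℤ | (fun i => (z i : ℝ)) ∈ (k : ℝ) • zigzagPolytope n}
      = zigzagTransfer n k '' (boundedPart (zigzagMaps n) k : Set (Fin n → ℕ)) := by
  ext z
  rw [Set.mem_ofPred_eq, intCast_mem_smul_zigzagPolytope]
  constructor
  · rintro ⟨h0, h1, h2⟩
    refine ⟨fun i => if i.val % 2 = 0 then (z i).toNat else (k - z i).toNat, ?_, ?_⟩
    · rw [Finset.mem_coe, mem_boundedPart]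
      refine ⟨fun i => ?_, fun l h hlh => ?_⟩
      · have h3 := h0 i
        have h4 := h1 i
        split_ifs <;> omega
      · obtain ⟨hl, hlh⟩ := hlh
        have hh : ¬h.val % 2 = 0 := by omega
        simp only [if_pos hl, if_neg hh]
        have h3 := h0 l
        have h4 := h0 h
        rcases hlh with hlh | hlh
        · have := h2 l h hlh
          omega
        · have := h2 h l hlh
          omega
    · funext i
      have h3 := h0 i
      have h4 := h1 i
      simp only [zigzagTransfer]
      split_ifs <;> omega
  · rintro ⟨f, hf, rfl⟩
    rw [Finset.mem_coe, mem_boundedPart] at hf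
    obtain ⟨hfk, hf⟩ := hf
    refine ⟨fun i => ?_, fun i => ?_, fun i j hij => ?_⟩
    · have := hfk i
      simp only [zigzagTransfer]
      split_ifs <;> omega
    · have := hfk i
      simp only [zigzagTransfer]
      split_ifs <;> omega
    · simp only [zigzagTransfer]
      rcases Nat.mod_two_eq_zero_or_one i.val with hi | hi
      · have := hf i j ⟨hi, Or.inl hij⟩
        rw [if_pos hi, if_neg (by omega)]
        omega
      · have := hf j i ⟨by omega, Or.inr hij⟩
        rw [if_neg (by omega), if_pos (by omega)]
        omega

theorem zigzagTransfer_injective (n k : ℕ) : Function.Injective (zigzagTransfer n k) := by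
  intro f g hfg
  funext i
  have := congrFun hfg i
  simp only [zigzagTransfer] at this
  split_ifs at this <;> omega

theorem ehrhartSeries_zigzagPolytope (n : ℕ) :
    ehrhartSeries (zigzagPolytope n) = boundedSeries (zigzagMaps n) := by
  ext k
  rw [ehrhartSeries, boundedSeries, PowerSeries.coeff_mk, PowerSeries.coeff_mk, latticePointCount,
    latticePoints_eq_image, Set.ncard_image_of_injective _ (zigzagTransfer_injective n k),
    Set.ncard_coe_finset]

theorem exists_numerator_zigzag (n : ℕ) (hn : 1 ≤ n) :
    ∃ d ≤ n, ∃ p ∈ gammaCone d,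
      boundedSeries (zigzagMaps n) * (1 - PowerSeries.X) ^ (n + 1) = (p : PowerSeries ℤ) := by
  have : Nonempty (Fin n) := ⟨⟨0, hn⟩⟩
  rcases Nat.lt_or_ge n 2 with hn2 | hn2
  · -- for `n = 1` the poset is a single isolated element
    have huniv : zigzagMaps n = Set.univ := by
      refine Set.eq_univ_of_forall fun f l h hlh => ?_
      have := hlh.2
      omega
    obtain ⟨d, hd, p, hp, h⟩ := exists_numerator_univ (Fin n)
    rw [Fintype.card_fin] at hd h
    exact ⟨d, by omega, p, hp, by rw [huniv, h]⟩
  · obtain ⟨d, hd, p, hp, h⟩ := exists_numerator_rankOne (Fin n) (fun i => i.val % 2 = 0)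
      (zigzagCover n) (fun l h hlh => ⟨hlh.1, by have := hlh.1; have := hlh.2; omega⟩)
      (fun h hh => ⟨⟨h.val - 1, by omega⟩, by simp only; omega, Or.inl (by simp only; omega)⟩)
      (fun l hl => by
        by_cases hlast : l.val + 1 < n
        · exact ⟨⟨l.val + 1, hlast⟩, hl, Or.inl rfl⟩
        · exact ⟨⟨l.val - 1, by omega⟩, hl, Or.inr (by simp only; omega)⟩)
    rw [Fintype.card_fin] at hd h
    exact ⟨d, by omega, p, hp, h⟩

end Zigzag

theorem mainTheorem1 (n : ℕ) (hn : 1 ≤ n) :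
    zigzagPolytope n = chainPolytope (ZigZag n) ∧
    ∃ δ : ℤ[X], IsEhrhartDelta (zigzagPolytope n) δ ∧ IsUnimodal δ := by
  obtain ⟨d, hd, p, hp, h⟩ := exists_numerator_zigzag n hn
  refine ⟨zigzagPolytope_eq_chainPolytope n, p, ⟨fun k => ?_, ?_, ?_⟩,
    isUnimodal_of_mem_gammaCone hp⟩
  · rw [latticePoints_eq_image]
    exact (Finset.finite_toSet _).image _
  · rw [affineDim_zigzagPolytope]
    exact (natDegree_le_of_mem_gammaCone hp).trans hd
  · rw [ehrhartSeries_zigzagPolytope, affineDim_zigzagPolytope, h]
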